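/- **Increment regularisation.** Let $0<\ell<r$. For an interval $I\subseteq[0,\infty)$ let $C(I)$ be the space of continuous functions $I\to\mathbb R$ with the Borel $\sigma$-algebra of the topology of uniform convergence on compact sets. Let $W$ be the law on $C([0,\infty))$ of a rate two Brownian motion started from the origin (i.e. of $\sqrt2$ times a standard Brownian motion), and let $\mu_{[a,b]}$ denote the law on $C([a,b])$ of its restriction to $[a,b]$. Let $B$ be a continuous process on $[0,\infty)$, i.e. a random element of $C([0,\infty))$, and let $\nu$ be the law on $C([\ell,r])$ of $B|_{[\ell,r]}$. Suppose that $\nu\ll\mu_{[\ell,r]}$ and that, for some non-negative measurable $f:\mathbb R^2\to\mathbb R$, $$\frac{d\nu}{d\mu_{[\ell,r]}}(\xi)\le f(\xi(\ell),\xi(r))\qquad\text{for }\mu_{[\ell,r]}\text{-a.e. }\xi\in C([\ell,r]).$$ Let $\lambda$ be Lebesgue measure on $\mathbb R$ and let $\Phi:C([\ell,r])\to C([0,r-\ell])$ be the map $\Phi(\xi)=\xi(\cdot+\ell)-\xi(\ell)$. Then: 1. The joint law of $\big(B(\ell),\,(B(t+\ell)-B(\ell))_{t\in[0,r-\ell]}\big)$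 on $\mathbb R\times C([0,r-\ell])$ is absolutely continuous with respect to $\lambda\times\mu_{[0,r-\ell]}$, and there is a non-negative measurable function $g:\mathbb R^2\to\mathbb R$, non-decreasing in its last argument if $f$ is, such that its Radon–Nikodym derivative at $(y,\xi)$ is at most $g(y,\xi(r-\ell))$ for $\lambda\times\mu_{[0,r-\ell]}$-a.e. $(y,\xi)\in\mathbb R\times C([0,r-\ell])$. 2. $\Phi_*\nu\ll\Phi_*\mu_{[\ell,r]}$, and for every real $p>1$, as an inequality in $[0,\infty]$, $$\left\|\frac{d\,\Phi_*\nu}{d\,\Phi_*\mu_{[\ell,r]}}\right\|_{L^p(\Phi_*\mu_{[\ell,r]})}\le\left\|\frac{d\nu}{d\mu_{[\ell,r]}}\right\|_{L^p(\mu_{[\ell,r]})}.$$ -/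

import Mathlib

open MeasureTheory ProbabilityTheory Set
open scoped NNReal ENNReal

/-- Spaces of continuous real functions carry the Borel σ-algebra of the compact-open topology
(uniform convergence on compact sets; uniform convergence if the domain is compact). -/
instance instMeasurableSpacePath {X : Type*} [TopologicalSpace X] : MeasurableSpace C(X, ℝ) :=
  borel _

instance instBorelSpacePath {X : Type*} [TopologicalSpace X] : BorelSpace C(X, ℝ) := ⟨rfl⟩

/-- `μ` is the rate two Wiener measure on `C([0,∞), ℝ)`: under `μ` the coordinate process is
`√2` times a standard Brownian motion started at the origin. -/
def IsRateTwoWienerMeasure (μ : Measure C(ℝ≥0, ℝ)) : Prop :=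
  IsBrownianReal (fun (t : ℝ≥0) (ξ : C(ℝ≥0, ℝ)) => ξ t / √(2 : ℝ)) μ

/-- The law on `C([a,b], ℝ)` of the restriction to `[a,b]` of a path with law `ν`
on `C([0,∞), ℝ)`. -/
noncomputable def lawOn (ν : Measure C(ℝ≥0, ℝ)) (a b : ℝ≥0) : Measure C(Icc a b, ℝ) :=
  ν.map (fun ξ => ξ.restrict (Icc a b))

/-- The time shift `t ↦ t + ℓ` from `[0, r - ℓ]` to `[ℓ, r]`. -/
def timeShift {ℓ r : ℝ≥0} (h : ℓ ≤ r) : C(Icc 0 (r - ℓ), Icc ℓ r) where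
  toFun t := ⟨t.1 + ℓ, le_add_self, (le_tsub_iff_right h).1 t.2.2⟩
  continuous_toFun := by fun_prop

/-- The left endpoint `ℓ` of `[ℓ, r]`. -/
def leftPt {ℓ r : ℝ≥0} (h : ℓ ≤ r) : Icc ℓ r := ⟨ℓ, left_mem_Icc.2 h⟩

/-- The right endpoint `r` of `[ℓ, r]`. -/
def rightPt {ℓ r : ℝ≥0} (h : ℓ ≤ r) : Icc ℓ r := ⟨r, right_mem_Icc.2 h⟩

/-- The increment map `ξ ↦ ξ(· + ℓ) - ξ(ℓ)` from paths on `[ℓ, r]` to paths on `[0, r - ℓ]`. -/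
noncomputable def incrementMap {ℓ r : ℝ≥0} (h : ℓ ≤ r) (ξ : C(Icc ℓ r, ℝ)) :
    C(Icc 0 (r - ℓ), ℝ) :=
  ξ.comp (timeShift h) - ContinuousMap.const _ (ξ (leftPt h))

/-- The increment map vanishes at time `0` and is given by the increments of the path. -/
theorem incrementMap_apply {ℓ r : ℝ≥0} (h : ℓ ≤ r) (ξ : C(Icc ℓ r, ℝ)) (t : Icc 0 (r - ℓ)) :
    incrementMap h ξ t = ξ (timeShift h t) - ξ (leftPt h) := rfl

theorem continuous_restrictPath (a b : ℝ≥0) :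
    Continuous (fun ξ : C(ℝ≥0, ℝ) => ξ.restrict (Icc a b)) :=
  ContinuousMap.continuous_restrict _

theorem continuous_incrementMap {ℓ r : ℝ≥0} (h : ℓ ≤ r) :
    Continuous (incrementMap h) := by
  unfold incrementMap
  refine (ContinuousMap.continuous_precomp _).sub ?_
  exact ContinuousMap.continuous_const'.comp (continuous_eval_const _)

/-- Passing from a path on `[0,∞)` to its value at `ℓ` and its increments on `[ℓ, r]`
is continuous, hence Borel measurable into the product. -/
theorem measurable_startIncrement {ℓ r : ℝ≥0} (h : ℓ ≤ r) :
    Measurable (fun ξ : C(ℝ≥0, ℝ) => (ξ ℓ, incrementMap h (ξ.restrict (Icc ℓ r)))) :=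
  (continuous_eval_const ℓ).measurable.prodMk
    ((continuous_incrementMap h).comp (continuous_restrictPath ℓ r)).measurable

/-! By independence and stationarity of Brownian increments, `startIncrement` carries `lawOn W ℓ r`
to a product of N(0, 2ℓ) and `lawOn W 0 (r - ℓ)`; as ℓ > 0, this is Lebesgue times Wiener weighted
by the Gaussian density (`IsRateTwoWienerMeasure.map_startIncrement`). The map is a measurable
embedding, so it preserves the density of B, and the chain rule multiplies that density by the
Gaussian one. The endpoint being start plus total increment, the bound becomes g(y, z) = gaussian(y)
f(y, y + z).

The L^p claim holds for any measurable map (`eLpNorm_rnDeriv_map_le`): test the pushed density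
against its own (p - 1)-st power, pull back, and apply Hölder. -/

/-! ### Contraction of `L^p` norms of densities under push-forward -/

section LpContraction

variable {α β : Type*} [MeasurableSpace α] [MeasurableSpace β]

/-- The `p`-th moment of a truncation of the density of the push-forward is at most the `p`-th
moment of the original density. -/
theorem lintegral_min_rnDeriv_map_rpow_le {μ ν : Measure α} [IsFiniteMeasure μ]
    [IsFiniteMeasure ν] (hνμ : ν ≪ μ) {φ : α → β} (hφ : Measurable φ) {p : ℝ} (hp : 1 < p)
    (n : ℕ) :
    ∫⁻ y, (min ((ν.map φ).rnDeriv (μ.map φ) y) n) ^ p ∂(μ.map φ)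
      ≤ ∫⁻ x, (ν.rnDeriv μ x) ^ p ∂μ := by
  set h := (ν.map φ).rnDeriv (μ.map φ) with hdef
  have hh : Measurable h := Measure.measurable_rnDeriv _ _
  set k : β → ℝ≥0∞ := fun y => min (h y) n with kdef
  have hk : Measurable k := hh.min measurable_const
  have hp0 : 0 < p := by linarith
  have hp1 : 0 < p - 1 := by linarith
  have hpq := Real.HolderConjugate.conjExponent hp
  set q := p.conjExponent with hq
  set A := ∫⁻ y, k y ^ p ∂(μ.map φ) with hA
  set M := ∫⁻ x, (ν.rnDeriv μ x) ^ p ∂μ with hM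
  -- Truncation at n serves only to make A finite, so that A ^ (1/q) can be cancelled below.
  have hAtop : A ≠ ∞ := by
    have : A ≤ ∫⁻ _, (n : ℝ≥0∞) ^ p ∂(μ.map φ) :=
      lintegral_mono fun y => ENNReal.rpow_le_rpow (min_le_right _ _) hp0.le
    refine ne_top_of_le_ne_top ?_ this
    rw [lintegral_const]
    exact ENNReal.mul_ne_top (ENNReal.rpow_ne_top_of_nonneg hp0.le (ENNReal.natCast_ne_top n))
      (measure_ne_top _ _)
  have hmul : A ≤ M ^ (1 / p) * A ^ (1 / q) := by
    calc A ≤ ∫⁻ y, h y * k y ^ (p - 1) ∂(μ.map φ) := by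
          refine lintegral_mono fun y => ?_
          have : k y ^ p = k y * k y ^ (p - 1) := by
            nth_rw 2 [← ENNReal.rpow_one (k y)]
            rw [← ENNReal.rpow_add_of_nonneg _ _ zero_le_one hp1.le]
            congr 1; ring
          change k y ^ p ≤ _
          rw [this]
          gcongr
          exact min_le_left _ _
      _ = ∫⁻ y, k y ^ (p - 1) ∂(ν.map φ) :=
          lintegral_rnDeriv_mul (hνμ.map hφ) (hk.pow_const _).aemeasurable
      _ = ∫⁻ x, k (φ x) ^ (p - 1) ∂ν := lintegral_map (hk.pow_const _) hφ
      _ = ∫⁻ x, ν.rnDeriv μ x * k (φ x) ^ (p - 1) ∂μ :=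
          (lintegral_rnDeriv_mul hνμ ((hk.comp hφ).pow_const _).aemeasurable).symm
      _ ≤ M ^ (1 / p) * (∫⁻ x, (k (φ x) ^ (p - 1)) ^ q ∂μ) ^ (1 / q) :=
          ENNReal.lintegral_mul_le_Lp_mul_Lq μ hpq (Measure.measurable_rnDeriv _ _).aemeasurable
            ((hk.comp hφ).pow_const _).aemeasurable
      _ = M ^ (1 / p) * A ^ (1 / q) := by
          congr 2
          rw [hA, lintegral_map (hk.pow_const _) hφ]
          refine lintegral_congr fun x => ?_
          rw [← ENNReal.rpow_mul, hpq.sub_one_mul_conj]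
  rcases eq_or_ne A 0 with hA0 | hA0
  · exact hA0 ▸ zero_le
  have hsplit : A = A ^ (1 / p) * A ^ (1 / q) := by
    rw [← ENNReal.rpow_add _ _ hA0 hAtop, one_div, one_div, hpq.inv_add_inv_eq_one,
      ENNReal.rpow_one]
  have hcancel : A ^ (1 / p) ≤ M ^ (1 / p) := by
    refine (ENNReal.mul_le_mul_iff_left (c := A ^ (1 / q)) ?_ ?_).1 (hsplit ▸ hmul)
    · exact (ENNReal.rpow_pos (pos_iff_ne_zero.2 hA0) hAtop).ne'
    · exact ENNReal.rpow_ne_top_of_nonneg (one_div_nonneg.2 hpq.symm.nonneg) hAtop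
  exact (ENNReal.rpow_le_rpow_iff (one_div_pos.2 hp0)).1 hcancel

/-- Push-forward contracts the `L^p` norm of Radon–Nikodym derivatives. -/
theorem eLpNorm_rnDeriv_map_le {μ ν : Measure α} [IsFiniteMeasure μ]
    [IsFiniteMeasure ν] (hνμ : ν ≪ μ) {φ : α → β} (hφ : Measurable φ) {p : ℝ} (hp : 1 < p) :
    eLpNorm ((ν.map φ).rnDeriv (μ.map φ)) (ENNReal.ofReal p) (μ.map φ)
      ≤ eLpNorm (ν.rnDeriv μ) (ENNReal.ofReal p) μ := by
  have hp0 : 0 < p := by linarith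
  have hpne : ENNReal.ofReal p ≠ 0 := (ENNReal.ofReal_pos.2 hp0).ne'
  rw [eLpNorm_eq_lintegral_rpow_enorm_toReal hpne ENNReal.ofReal_ne_top,
    eLpNorm_eq_lintegral_rpow_enorm_toReal hpne ENNReal.ofReal_ne_top, ENNReal.toReal_ofReal hp0.le]
  simp only [enorm_eq_self]
  refine ENNReal.rpow_le_rpow ?_ (one_div_nonneg.2 hp0.le)
  -- Monotone convergence removes the truncation.
  refine le_of_tendsto' (lintegral_tendsto_of_tendsto_of_monotone
    (f := fun n y => (min ((ν.map φ).rnDeriv (μ.map φ) y) (n : ℕ)) ^ p)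
    (fun n => (((Measure.measurable_rnDeriv _ _).min measurable_const).pow_const _).aemeasurable)
    (.of_forall fun y m n hmn => ?_) (.of_forall fun y => ?_))
    (lintegral_min_rnDeriv_map_rpow_le hνμ hφ hp)
  · exact ENNReal.rpow_le_rpow (min_le_min_left _ (by exact_mod_cast hmn)) hp0.le
  · have := (tendsto_const_nhds (x := (ν.map φ).rnDeriv (μ.map φ) y)).min
      ENNReal.tendsto_nat_nhds_top
    rw [min_top_right] at this
    exact (ENNReal.continuous_rpow_const.tendsto _).comp this

end LpContraction

/-! ### The Borel σ-algebra on path space is generated by evaluations -/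

theorem comap_eval_eq_borel (K : Type*) [TopologicalSpace K] [CompactSpace K]
    [TopologicalSpace.MetrizableSpace K] :
    MeasurableSpace.comap (fun (ξ : C(K, ℝ)) (t : K) => ξ t) MeasurableSpace.pi
      = instMeasurableSpacePath := by
  let _ := TopologicalSpace.metrizableSpaceMetric K
  have hev : Measurable (fun (ξ : C(K, ℝ)) (t : K) => ξ t) :=
    measurable_pi_lambda _ fun t => (continuous_eval_const t).measurable
  refine le_antisymm hev.comap_le ?_
  obtain ⟨D, hDc, hD⟩ := TopologicalSpace.exists_countable_dense K
  have : Countable D := hDc.to_subtype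
  -- Lusin–Souslin: C(K, ℝ) is Polish, and evaluation on the countable dense set D is continuous and
  -- injective.
  have hemb : MeasurableEmbedding (fun (ξ : C(K, ℝ)) (t : D) => ξ t) := by
    refine Continuous.measurableEmbedding
      (continuous_pi fun t => continuous_eval_const t.1) fun ξ η h => ?_
    exact DFunLike.coe_injective (ξ.continuous.ext_on hD η.continuous
      fun t ht => congrFun h ⟨t, ht⟩)
  rw [← hemb.comap_eq]
  have hres : Measurable (fun (x : K → ℝ) (t : D) => x t) :=
    measurable_pi_lambda _ fun t => measurable_pi_apply t.1
  change MeasurableSpace.comap ((fun (x : K → ℝ) (t : D) => x t) ∘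
    (fun (ξ : C(K, ℝ)) (t : K) => ξ t)) _ ≤ _
  rw [← MeasurableSpace.comap_comp]
  exact MeasurableSpace.comap_mono hres.comap_le

/-- Random paths with the same law as processes have the same law on path space. -/
theorem map_path_eq_of_map_eval_eq {Ω K : Type*} [MeasurableSpace Ω] [TopologicalSpace K]
    [CompactSpace K] [TopologicalSpace.MetrizableSpace K] {P : Measure Ω} {X Y : Ω → C(K, ℝ)}
    (hX : Measurable X) (hY : Measurable Y)
    (h : P.map (fun ω t => X ω t) = P.map (fun ω t => Y ω t)) : P.map X = P.map Y := by
  have hev : Measurable (fun (ξ : C(K, ℝ)) (t : K) => ξ t) :=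
    measurable_pi_lambda _ fun t => (continuous_eval_const t).measurable
  refine Measure.ext fun s hs => ?_
  rw [← comap_eval_eq_borel K] at hs
  obtain ⟨u, hu, rfl⟩ := hs
  rw [← Measure.map_apply hev hu, ← Measure.map_apply hev hu, Measure.map_map hev hX,
    Measure.map_map hev hY]
  exact congrArg (fun m => m u) h

/-- A random path is independent of a random variable as soon as its evaluations are. -/
theorem indepFun_path_of_indepFun_eval {Ω K γ : Type*} [MeasurableSpace Ω] [TopologicalSpace K]
    [CompactSpace K] [TopologicalSpace.MetrizableSpace K] [MeasurableSpace γ] {P : Measure Ω}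
    {X : Ω → C(K, ℝ)} {Y : Ω → γ} (h : IndepFun (fun ω t => X ω t) Y P) : IndepFun X Y P := by
  rw [IndepFun_iff_Indep] at h ⊢
  rw [← comap_eval_eq_borel K, MeasurableSpace.comap_comp]
  exact h

/-! ### The starting value and the increments of Brownian motion -/

/-- Finite-dimensional marginals determine a law on the product σ-algebra. -/
theorem IsPreBrownianReal.map_eval_unique {Ω : Type*} [MeasurableSpace Ω] {P : Measure Ω}
    {X Y : ℝ≥0 → Ω → ℝ} (hX : IsPreBrownianReal X P) (hY : IsPreBrownianReal Y P)
    (hXm : Measurable fun ω t => X t ω) (hYm : Measurable fun ω t => Y t ω) :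
    P.map (fun ω t => X t ω) = P.map (fun ω t => Y t ω) := by
  have := hX.isGaussianProcess.isProbabilityMeasure
  exact (map_eq_iff_forall_finset_map_restrict_eq hXm.aemeasurable hYm.aemeasurable).2
    fun I => (hX.hasLaw I).map_eq.trans (hY.hasLaw I).map_eq.symm

section Wiener

variable {W : Measure C(ℝ≥0, ℝ)} {ℓ r : ℝ≥0}

theorem measurable_incrementMap_restrict (h : ℓ ≤ r) :
    Measurable fun ξ : C(ℝ≥0, ℝ) => incrementMap h (ξ.restrict (Icc ℓ r)) :=
  ((continuous_incrementMap h).comp (continuous_restrictPath ℓ r)).measurable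

theorem measurable_scaled_eval :
    Measurable fun (ξ : C(ℝ≥0, ℝ)) (t : ℝ≥0) => ξ t / √(2 : ℝ) :=
  measurable_pi_lambda _ fun t => (continuous_eval_const t).measurable.div_const _

/-- The bracket is the shifted standard Brownian motion, to which the Markov-type results apply. -/
theorem incrementMap_restrict_apply (h : ℓ ≤ r) (ξ : C(ℝ≥0, ℝ)) (t : Icc 0 (r - ℓ)) :
    incrementMap h (ξ.restrict (Icc ℓ r)) t = √2 * (ξ (ℓ + t) / √2 - ξ ℓ / √2) := by
  have h2 : √(2 : ℝ) ≠ 0 := by positivity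
  rw [← sub_div, mul_div_cancel₀ _ h2, add_comm ℓ]
  rfl

/-- Stationarity: the increments after time `ℓ` have the law of the path from time `0`. -/
theorem IsRateTwoWienerMeasure.map_incrementMap (hW : IsRateTwoWienerMeasure W) (h : ℓ ≤ r) :
    (lawOn W ℓ r).map (incrementMap h) = lawOn W 0 (r - ℓ) := by
  have h2 : √(2 : ℝ) ≠ 0 := by positivity
  rw [lawOn, lawOn, Measure.map_map (continuous_incrementMap h).measurable
    (continuous_restrictPath ℓ r).measurable]
  refine map_path_eq_of_map_eval_eq (measurable_incrementMap_restrict h)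
    (continuous_restrictPath 0 (r - ℓ)).measurable ?_
  have hshift : Measurable fun (ξ : C(ℝ≥0, ℝ)) (t : ℝ≥0) => ξ (ℓ + t) / √(2 : ℝ) - ξ ℓ / √2 :=
    measurable_pi_lambda _ fun t => ((continuous_eval_const (ℓ + t)).measurable.div_const _).sub
      ((continuous_eval_const ℓ).measurable.div_const _)
  have key := IsPreBrownianReal.map_eval_unique (hW.toIsPreBrownianReal.shift ℓ)
    hW.toIsPreBrownianReal hshift measurable_scaled_eval
  have hres : Measurable fun (x : ℝ≥0 → ℝ) (t : Icc 0 (r - ℓ)) => √2 * x t :=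
    measurable_pi_lambda _ fun t => (measurable_pi_apply t.1).const_mul _
  have := congrArg (Measure.map fun (x : ℝ≥0 → ℝ) (t : Icc 0 (r - ℓ)) => √2 * x t) key
  rw [Measure.map_map hres hshift, Measure.map_map hres measurable_scaled_eval] at this
  convert this using 2
  · funext ξ t
    exact incrementMap_restrict_apply h ξ t
  · funext ξ t
    exact (mul_div_cancel₀ _ h2).symm

/-- The law at a fixed time. -/
theorem IsRateTwoWienerMeasure.map_eval (hW : IsRateTwoWienerMeasure W) (t : ℝ≥0) :
    W.map (fun ξ => ξ t) = gaussianReal 0 (2 * t) := by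
  have h2 : √(2 : ℝ) ≠ 0 := by positivity
  have hm : Measurable fun ξ : C(ℝ≥0, ℝ) => ξ t / √(2 : ℝ) :=
    (continuous_eval_const t).measurable.div_const _
  have := congrArg (Measure.map (√2 * ·)) (hW.hasLaw_eval t).map_eq
  rw [Measure.map_map (by fun_prop) hm, gaussianReal_map_const_mul, mul_zero] at this
  convert this using 2
  · funext ξ
    exact (mul_div_cancel₀ _ h2).symm
  · congr 1
    ext
    simp

/-- Independence of the value at time `ℓ` and the increments after time `ℓ`. -/
theorem IsRateTwoWienerMeasure.indepFun_eval_incrementMap (hW : IsRateTwoWienerMeasure W)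
    (h : ℓ ≤ r) :
    IndepFun (fun ξ : C(ℝ≥0, ℝ) => ξ ℓ) (fun ξ => incrementMap h (ξ.restrict (Icc ℓ r))) W := by
  have h2 : √(2 : ℝ) ≠ 0 := by positivity
  refine (indepFun_path_of_indepFun_eval ?_).symm
  have hres : Measurable fun (x : ℝ≥0 → ℝ) (t : Icc 0 (r - ℓ)) => √2 * x t :=
    measurable_pi_lambda _ fun t => (measurable_pi_apply t.1).const_mul _
  have hend : Measurable fun x : Iic ℓ → ℝ => √2 * x ⟨ℓ, mem_Iic.2 le_rfl⟩ :=
    (measurable_pi_apply _).const_mul _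
  convert (hW.toIsPreBrownianReal.indepFun_shift ℓ).comp hres hend using 1
  · funext ξ t
    exact incrementMap_restrict_apply h ξ t
  · funext ξ
    exact (mul_div_cancel₀ _ h2).symm

end Wiener

/-! ### Splitting a path into its starting value and its increments -/

section Split

variable {ℓ r : ℝ≥0}

/-- The starting value and the increments of a path on `[ℓ, r]`. -/
noncomputable def startIncrement (h : ℓ ≤ r) (ξ : C(Icc ℓ r, ℝ)) :
    ℝ × C(Icc 0 (r - ℓ), ℝ) :=
  (ξ (leftPt h), incrementMap h ξ)

theorem startIncrement_snd_rightPt (h : ℓ ≤ r) (ξ : C(Icc ℓ r, ℝ)) :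
    (startIncrement h ξ).1 + (startIncrement h ξ).2 (rightPt (zero_le : 0 ≤ r - ℓ))
      = ξ (rightPt h) := by
  have : timeShift h (rightPt (zero_le : 0 ≤ r - ℓ)) = rightPt h :=
    Subtype.ext (tsub_add_cancel_of_le h)
  simp [startIncrement, incrementMap_apply, this]

/-- A path is recovered from its start and its increments, so Lusin–Souslin applies again. -/
theorem measurableEmbedding_startIncrement (h : ℓ ≤ r) :
    MeasurableEmbedding (startIncrement h) := by
  refine Continuous.measurableEmbedding
    ((continuous_eval_const _).prodMk (continuous_incrementMap h)) fun ξ η hξη => ?_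
  have h1 : ξ (leftPt h) = η (leftPt h) := congrArg Prod.fst hξη
  have h2 : incrementMap h ξ = incrementMap h η := congrArg Prod.snd hξη
  ext t
  have ht : timeShift h ⟨t.1 - ℓ, zero_le, tsub_le_tsub_right t.2.2 ℓ⟩ = t :=
    Subtype.ext (tsub_add_cancel_of_le t.2.1)
  have h3 := DFunLike.congr_fun h2 ⟨t.1 - ℓ, zero_le, tsub_le_tsub_right t.2.2 ℓ⟩
  rw [incrementMap_apply, incrementMap_apply, ht, h1] at h3
  exact sub_left_injective h3

theorem map_startIncrement_lawOn (h : ℓ ≤ r) (ν : Measure C(ℝ≥0, ℝ)) :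
    (lawOn ν ℓ r).map (startIncrement h)
      = ν.map fun ξ => (ξ ℓ, incrementMap h (ξ.restrict (Icc ℓ r))) := by
  rw [lawOn, Measure.map_map (measurableEmbedding_startIncrement h).measurable
    (continuous_restrictPath ℓ r).measurable]
  rfl

theorem IsRateTwoWienerMeasure.isProbabilityMeasure {W : Measure C(ℝ≥0, ℝ)}
    (hW : IsRateTwoWienerMeasure W) : IsProbabilityMeasure W :=
  hW.toIsPreBrownianReal.isGaussianProcess.isProbabilityMeasure

instance isFiniteMeasure_lawOn (ν : Measure C(ℝ≥0, ℝ)) [IsFiniteMeasure ν] (a b : ℝ≥0) :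
    IsFiniteMeasure (lawOn ν a b) := by
  unfold lawOn; infer_instance

/-- Positivity of ℓ makes the starting value a nondegenerate Gaussian, hence one with a Lebesgue
density. -/
theorem IsRateTwoWienerMeasure.map_startIncrement {W : Measure C(ℝ≥0, ℝ)}
    (hW : IsRateTwoWienerMeasure W) (hℓ : 0 < ℓ) (h : ℓ ≤ r) :
    (lawOn W ℓ r).map (startIncrement h)
      = ((volume : Measure ℝ).prod (lawOn W 0 (r - ℓ))).withDensity
          fun q => gaussianPDF 0 (2 * ℓ) q.1 := by
  have := hW.isProbabilityMeasure
  have hind := (indepFun_iff_map_prod_eq_prod_map_map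
    (continuous_eval_const ℓ).measurable.aemeasurable
    (measurable_incrementMap_restrict h).aemeasurable).1 (hW.indepFun_eval_incrementMap h)
  have hinc : W.map (fun ξ => incrementMap h (ξ.restrict (Icc ℓ r))) = lawOn W 0 (r - ℓ) := by
    rw [← hW.map_incrementMap h, lawOn, Measure.map_map (continuous_incrementMap h).measurable
      (continuous_restrictPath ℓ r).measurable]
    rfl
  rw [map_startIncrement_lawOn, hind, hinc, hW.map_eval,
    gaussianReal_of_var_ne_zero _ (mul_pos two_pos hℓ).ne',
    prod_withDensity_left (measurable_gaussianPDF _ _)]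

end Split

theorem mainTheorem9
    {Ω : Type*} [MeasurableSpace Ω] (P : Measure Ω) [IsProbabilityMeasure P]
    (W : Measure C(ℝ≥0, ℝ)) (hW : IsRateTwoWienerMeasure W)
    (ℓ r : ℝ≥0) (hℓ : 0 < ℓ) (hℓr : ℓ < r)
    (B : Ω → C(ℝ≥0, ℝ)) (hB : Measurable B)
    (hac : lawOn (P.map B) ℓ r ≪ lawOn W ℓ r)
    (f : ℝ × ℝ → ℝ) (hf : Measurable f) (hf0 : ∀ z, 0 ≤ f z)
    (hbound : ∀ᵐ ξ ∂(lawOn W ℓ r),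
      (lawOn (P.map B) ℓ r).rnDeriv (lawOn W ℓ r) ξ
        ≤ ENNReal.ofReal (f (ξ (leftPt hℓr.le), ξ (rightPt hℓr.le)))) :
    (P.map (fun ω => (B ω ℓ, incrementMap hℓr.le ((B ω).restrict (Icc ℓ r))))
        ≪ (volume : Measure ℝ).prod (lawOn W 0 (r - ℓ))) ∧
    (∃ g : ℝ × ℝ → ℝ, Measurable g ∧ (∀ z, 0 ≤ g z) ∧
      ((∀ x, Monotone (fun y => f (x, y))) → ∀ x, Monotone (fun y => g (x, y))) ∧
      ∀ᵐ q ∂((volume : Measure ℝ).prod (lawOn W 0 (r - ℓ))),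
        (P.map (fun ω => (B ω ℓ, incrementMap hℓr.le ((B ω).restrict (Icc ℓ r))))).rnDeriv
            ((volume : Measure ℝ).prod (lawOn W 0 (r - ℓ))) q
          ≤ ENNReal.ofReal (g (q.1, q.2 (rightPt (zero_le : 0 ≤ r - ℓ))))) ∧
    ((lawOn (P.map B) ℓ r).map (incrementMap hℓr.le)
        ≪ (lawOn W ℓ r).map (incrementMap hℓr.le)) ∧
    (∀ p : ℝ, 1 < p →
      eLpNorm
          (((lawOn (P.map B) ℓ r).map (incrementMap hℓr.le)).rnDeriv
            ((lawOn W ℓ r).map (incrementMap hℓr.le)))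
          (ENNReal.ofReal p) ((lawOn W ℓ r).map (incrementMap hℓr.le))
        ≤ eLpNorm ((lawOn (P.map B) ℓ r).rnDeriv (lawOn W ℓ r))
            (ENNReal.ofReal p) (lawOn W ℓ r)) := by
  have hWp := hW.isProbabilityMeasure
  have hPB : IsProbabilityMeasure (P.map B) := Measure.isProbabilityMeasure_map hB.aemeasurable
  set μ := lawOn W ℓ r with hμ
  set ν := lawOn (P.map B) ℓ r with hν
  set m := (volume : Measure ℝ).prod (lawOn W 0 (r - ℓ)) with hm
  have hT := measurableEmbedding_startIncrement hℓr.le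
  set T := startIncrement hℓr.le with hTdef
  have hpdf : Measurable fun q : ℝ × C(Icc 0 (r - ℓ), ℝ) => gaussianPDF 0 (2 * ℓ) q.1 :=
    (measurable_gaussianPDF _ _).comp measurable_fst
  have hμT : μ.map T = m.withDensity fun q => gaussianPDF 0 (2 * ℓ) q.1 :=
    hW.map_startIncrement hℓ hℓr.le
  have hνT : P.map (fun ω => (B ω ℓ, incrementMap hℓr.le ((B ω).restrict (Icc ℓ r))))
      = ν.map T := by
    rw [hν, map_startIncrement_lawOn, Measure.map_map (measurable_startIncrement hℓr.le) hB]
    rfl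
  have hacT : ν.map T ≪ μ.map T := hac.map hT.measurable
  have hacμ : μ.map T ≪ m := hμT ▸ withDensity_absolutelyContinuous _ _
  rw [hνT]
  refine ⟨hacT.trans hacμ, ⟨fun z => gaussianPDFReal 0 (2 * ℓ) z.1 * f (z.1, z.1 + z.2), ?_,
    fun z => mul_nonneg (gaussianPDFReal_nonneg _ _ _) (hf0 _), fun hmono x y₁ y₂ hy => ?_, ?_⟩,
    hac.map (continuous_incrementMap hℓr.le).measurable,
    fun p hp => eLpNorm_rnDeriv_map_le hac (continuous_incrementMap hℓr.le).measurable hp⟩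
  · exact ((measurable_gaussianPDFReal _ _).comp measurable_fst).mul
      (hf.comp (measurable_fst.prodMk (measurable_fst.add measurable_snd)))
  · exact mul_le_mul_of_nonneg_left (hmono x (add_le_add_right hy x)) (gaussianPDFReal_nonneg _ _ _)
  have hboundT : ∀ᵐ q ∂(μ.map T), (ν.map T).rnDeriv (μ.map T) q
      ≤ ENNReal.ofReal (f (q.1, q.1 + q.2 (rightPt (zero_le : 0 ≤ r - ℓ)))) := by
    rw [hT.ae_map_iff]
    filter_upwards [hbound, hT.rnDeriv_map ν μ] with ξ hξ hd
    rw [hd, hTdef, startIncrement_snd_rightPt]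
    exact hξ
  -- The bound now holds m-a.e. where the Gaussian density is nonzero, that is, everywhere (`hpos`).
  rw [hμT, ae_withDensity_iff hpdf] at hboundT
  have hdens : (μ.map T).rnDeriv m =ᵐ[m] fun q => gaussianPDF 0 (2 * ℓ) q.1 :=
    hμT ▸ Measure.rnDeriv_withDensity m hpdf
  filter_upwards [hboundT, hdens, Measure.rnDeriv_mul_rnDeriv (κ := m) hacT] with q hq hd hmul
  have hpos : gaussianPDF 0 (2 * ℓ) q.1 ≠ 0 :=
    (gaussianPDF_pos 0 (mul_pos two_pos hℓ).ne' q.1).ne'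
  rw [← hmul, Pi.mul_apply, hd, mul_comm,
    ENNReal.ofReal_mul (gaussianPDFReal_nonneg _ _ _), hμT]
  exact mul_le_mul_right (hq hpos) _
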